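/- Theorem (porous medium type inequality). Let $N\ge 2$, $\gamma\ge 1$, and let $f:\mathbb R\to\mathbb R$ be continuous. A solution of $$-\Delta(|u|^{\gamma-1}u)\ge f(u)\quad\text{on }\mathbb R^N \qquad (\ast)$$ is a function $u\in C^1(\mathbb R^N)$ such that $$\int_{\mathbb R^N}\nabla(|u|^{\gamma-1}u)\cdot\nabla\varphi\,dx\ \ge\ \int_{\mathbb R^N} f(u)\,\varphi\,dx$$ for every nonnegative compactly supported $\varphi\in C^1(\mathbb R^N)$. Let $u$ be a solution of $(\ast)$. (i) If $f(t)>0$ for $t<0$, $f$ is non-increasing on $(-\infty,0)$, and $$\int_{-\infty}^{-1}|t|^{\gamma-1}\left(\int_t^{-1}f(s)|s|^{\gamma-1}\,ds\right)^{-1/2}dt<+\infty,$$ then $u\ge 0$ on $\mathbb R^N$. (ii) If there are constants $C>0$ and $q>\gamma$ such that $f(t)\ge C|t|^q$ for all $t<0$, then $u\ge 0$ on $\mathbb R^N$. If moreover $f(t)\ge 0$ for all $t\ge 0$, then either $u\equiv 0$ or $u>0$ on $\mathbb R^N$. -/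

import Mathlib

open MeasureTheory Set

/-- The odd power `|t|^(γ-1) t`. -/
noncomputable def signedPow (γ t : ℝ) : ℝ := |t| ^ (γ - 1) * t

/-- `u` is a (weak, `C¹`) solution of `-Δ(|u|^(γ-1) u) ≥ f(u)` on `ℝ^N`: `u` is of class `C¹` and
`∫ ∇(|u|^(γ-1) u) · ∇φ ≥ ∫ f(u) φ` for every nonnegative compactly supported `φ` of class `C¹`.
For `γ ≥ 1` and continuous `f`, the function `|u|^(γ-1) u` is itself of class `C¹` and both
integrands are continuous with compact support. -/
def IsPorousSupersolution (N : ℕ) (γ : ℝ) (f : ℝ → ℝ) (u : EuclideanSpace ℝ (Fin N) → ℝ) : Prop :=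
  ContDiff ℝ 1 u ∧
    ∀ φ : EuclideanSpace ℝ (Fin N) → ℝ, ContDiff ℝ 1 φ → HasCompactSupport φ → (∀ x, 0 ≤ φ x) →
      ∫ x, f (u x) * φ x ≤
        ∫ x, inner ℝ (gradient (fun y => signedPow γ (u y)) x) (gradient φ x)

/-- `f` is positive and non-increasing on the open negative half-line. -/
def PosAntitoneOnNeg (f : ℝ → ℝ) : Prop :=
  (∀ t < 0, 0 < f t) ∧ AntitoneOn f (Iio 0)

/-- The weighted Keller–Osserman condition at `-∞`:
`∫_{-∞}^{-1} |t|^(γ-1) (∫_t^{-1} f(s) |s|^(γ-1) ds)^(-1/2) dt < ∞`.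
It is used for continuous `f` that are positive on the negative half-line, so that the integrand is
positive and continuous on `]-∞, -1[`, and integrability is finiteness of the integral. -/
def WeightedKellerOsserman (γ : ℝ) (f : ℝ → ℝ) : Prop :=
  IntegrableOn
    (fun t : ℝ => |t| ^ (γ - 1) * (∫ s in t..(-1 : ℝ), f s * |s| ^ (γ - 1)) ^ (-(1 / 2) : ℝ))
    (Iio (-1))

/-! Put `v = signedPow γ ∘ u`. Since `γ ≥ 1`, `v` is `C¹`, has the sign of `u`, and satisfies `-Δv ≥
f(u)` weakly. Where `v < 0` this gives `-Δv ≥ h(-v)` with `h` positive and non-decreasing: `h(s) =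
f(-s^(1/γ))` in (i), `h(s) = C s^(q/γ)` in (ii). The substitution `t = -s^(1/γ)` turns the weighted
condition into the classical Keller–Osserman condition for `h`; for the power it holds because `q/γ
> 1`.

Nonnegativity (`nonneg_of_kellerOsserman`) is a barrier argument. If `v(x₀) < 0`, take `0 < a <
-v(x₀)` and solve `φ'' = h(φ)/N`, `φ(0) = a`, `φ'(0) = 0`, with `h` truncated above a level `M`. The
Keller–Osserman condition makes `φ` reach `M` by a radius `R` that does not depend on `M`
(`exists_radius_of_kellerOsserman`), so `M` can be chosen above the maximum of `-v` on the ball of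
radius `R`. As `φ' ≤ r φ''`, the radial function `φ(|x - x₀|)` has Laplacian at most `N φ''`, which
is `h(φ)` below `M`. Comparison on the ball (`neg_le_of_isWeakSupersolution`) then yields `-v(x₀) ≤
φ(0) = a`, a contradiction.

For the dichotomy `u ≡ 0` or `u > 0`, weighted averages of the superharmonic function `v ≥ 0` over
balls about a zero are non-increasing in the radius and start at 0
(`eq_zero_of_isWeakSupersolution`). -/

/-! ### Existence for the second-order equation -/

/-- Separation of variables for `Y' = 1/θ(Y)`: the lower bound `δ` makes `Θ` a bijection of the
line, so its inverse is a global solution. -/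
theorem exists_hasDerivAt_inverse {Θ θ : ℝ → ℝ} {δ : ℝ} (hδ : 0 < δ) (hθ : ∀ y, δ ≤ θ y)
    (h : ∀ y, HasDerivAt Θ (θ y) y) (h0 : Θ 0 = 0) :
    ∃ Y : ℝ → ℝ, Y 0 = 0 ∧ ∀ r, HasDerivAt Y (θ (Y r))⁻¹ r := by
  have hc : Continuous Θ := continuous_iff_continuousAt.2 fun y => (h y).continuousAt
  have hm : StrictMono Θ := strictMono_of_deriv_pos fun y => by
    rw [(h y).deriv]; exact hδ.trans_le (hθ y)
  have hlin : Monotone fun y => Θ y - δ * y := by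
    apply monotone_of_deriv_nonneg
    · exact fun y => ((h y).sub ((hasDerivAt_id y).const_mul δ)).differentiableAt
    · intro y
      have := ((h y).sub ((hasDerivAt_id' y).const_mul δ)).deriv
      simp only [mul_one] at this
      have e : (fun y => Θ y - δ * y) = Θ - fun y => δ * y := rfl
      rw [e, this]; linarith [hθ y]
  have htop : Filter.Tendsto Θ Filter.atTop Filter.atTop := by
    refine Filter.tendsto_atTop_mono' _ ?_ (Filter.tendsto_id.const_mul_atTop hδ)
    filter_upwards [Filter.eventually_ge_atTop 0] with y hy
    have := hlin hy
    simp [h0] at this ⊢; linarith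
  have hbot : Filter.Tendsto Θ Filter.atBot Filter.atBot := by
    refine Filter.tendsto_atBot_mono' _ ?_ (Filter.tendsto_id.const_mul_atBot hδ)
    filter_upwards [Filter.eventually_le_atBot 0] with y hy
    have := hlin hy
    simp [h0] at this ⊢; linarith
  let e := hm.orderIsoOfSurjective Θ (hc.surjective htop hbot)
  have he : ∀ r, Θ (e.symm r) = r := e.apply_symm_apply
  refine ⟨e.symm, hm.injective (by rw [he, h0]), fun r => ?_⟩
  exact HasDerivAt.of_local_left_inverse e.symm.continuous.continuousAt (h _)
    (hδ.trans_le (hθ _)).ne' (Filter.Eventually.of_forall he)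

/-- Global solvability of `φ'' = G(φ)`, `φ(0) = a`, `φ'(0) = 0` for continuous `G` with values in
`[m, L]`, `m > 0`. -/
theorem exists_second_order_solution {G : ℝ → ℝ} (hG : Continuous G) {m L : ℝ} (hm : 0 < m)
    (hl : ∀ s, m ≤ G s) (hu : ∀ s, G s ≤ L) (a : ℝ) :
    ∃ φ φ₁ : ℝ → ℝ, φ 0 = a ∧ φ₁ 0 = 0 ∧ (∀ r, HasDerivAt φ (φ₁ r) r) ∧
      ∀ r, HasDerivAt φ₁ (G (φ r)) r := by
  -- Energy conservation `φ'² = 2 ∫_a^φ G` degenerates at the starting point. Writing `φ = a + Y²`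
  -- removes the degeneracy: the equation becomes `Y' = √K(Y) / 2` with `K` continuous and between
  -- `2m` and `2L`, so no Lipschitz condition on `G` is needed.
  set K : ℝ → ℝ := fun y => 2 * ∫ θ in (0 : ℝ)..1, G (a + θ * y ^ 2) with hK
  have hKc : Continuous K := by
    refine continuous_const.mul ?_
    apply intervalIntegral.continuous_parametric_intervalIntegral_of_continuous'
    fun_prop
  have hint : ∀ y, IntervalIntegrable (fun θ => G (a + θ * y ^ 2)) volume 0 1 := fun y =>
    Continuous.intervalIntegrable (by fun_prop) _ _
  have hKl : ∀ y, 2 * m ≤ K y := fun y => by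
    have := intervalIntegral.integral_mono_on (μ := volume) zero_le_one
      (continuous_const (y := m) |>.intervalIntegrable _ _) (hint y) fun θ _ => hl _
    simp at this; simp only [hK]; linarith
  have hKu : ∀ y, K y ≤ 2 * L := fun y => by
    have := intervalIntegral.integral_mono_on (μ := volume) zero_le_one
      (hint y) (continuous_const (y := L) |>.intervalIntegrable _ _) fun θ _ => hu _
    simp at this; simp only [hK]; linarith
  have hKpos : ∀ y, 0 < K y := fun y => by linarith [hKl y]
  have hL : 0 < L := hm.trans_le ((hl 0).trans (hu 0))
  have hKH : ∀ y, y ≠ 0 → K y = 2 * (∫ s in a..(a + y ^ 2), G s) / y ^ 2 := fun y hy => by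
    have h1 := intervalIntegral.integral_comp_add_mul (a := 0) (b := 1) G (c := y ^ 2)
      (by positivity) a
    simp only [hK]
    simp_rw [mul_comm _ (y ^ 2)]
    rw [h1]; simp; field_simp
  have hs : Continuous fun y => 2 / √(K y) :=
    continuous_const.div (by fun_prop) fun y => (Real.sqrt_pos.2 (hKpos y)).ne'
  obtain ⟨Y, hY0, hY⟩ := exists_hasDerivAt_inverse (Θ := fun y => ∫ x in (0 : ℝ)..y, 2 / √(K x))
    (δ := 2 / √(2 * L)) (by positivity)
    (fun y => by
      have := Real.sqrt_pos.2 (hKpos y)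
      gcongr; exact hKu y)
    (fun y => (hs.integral_hasStrictDerivAt 0 y).hasDerivAt) (by simp)
  have hY' : ∀ r, HasDerivAt Y (√(K (Y r)) / 2) r := fun r => by simpa using hY r
  have hsq : ∀ y, √(K y) * √(K y) = K y := fun y => Real.mul_self_sqrt (hKpos y).le
  refine ⟨fun r => a + Y r ^ 2, fun r => Y r * √(K (Y r)), by simp [hY0], by simp [hY0],
    fun r => ?_, fun r => ?_⟩
  · have := ((hY' r).pow 2).const_add a
    exact this.congr_deriv (by norm_num; ring)
  -- `K` need not be differentiable at 0, but there `Y` vanishes, so the difference quotient of `Y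
  -- √K(Y)` is that of `Y` times the continuous factor `√K(Y)`.
  · by_cases h0 : Y r = 0
    · rw [hasDerivAt_iff_tendsto_slope]
      have h1 := (hasDerivAt_iff_tendsto_slope.1 (hY' r)).mul
        ((Real.continuous_sqrt.comp (hKc.comp
          (continuous_iff_continuousAt.2 fun r => (hY' r).continuousAt))).tendsto r |>.mono_left
          (nhdsWithin_le_nhds (s := {r}ᶜ)))
      refine (h1.congr' (Filter.Eventually.of_forall fun x => ?_)).trans_eq ?_
      · simp [slope_def_field, h0]; ring
      · have : K 0 = 2 * G a := by simp [hK]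
        simp only [Function.comp, h0]
        rw [div_mul_eq_mul_div, hsq, this]; simp
    · have hKd : HasDerivAt K (4 * G (a + Y r ^ 2) / Y r - 2 * K (Y r) / Y r) (Y r) := by
        have h1 : HasDerivAt (fun s => ∫ t in a..s, G t) (G (a + Y r ^ 2)) (a + Y r ^ 2) :=
          (hG.integral_hasStrictDerivAt a _).hasDerivAt
        have h2 : HasDerivAt (fun y : ℝ => a + y ^ 2) (2 * Y r) (Y r) := by
          simpa using ((hasDerivAt_id (Y r)).pow 2).const_add a
        have h3 := ((h1.comp (Y r) h2).const_mul 2).div ((hasDerivAt_id (Y r)).pow 2)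
          (by simpa using h0)
        have h4 : K =ᶠ[nhds (Y r)] fun y => 2 * (∫ s in a..(a + y ^ 2), G s) / y ^ 2 := by
          filter_upwards [isOpen_ne.mem_nhds h0] with y hy using hKH y hy
        refine HasDerivAt.congr_of_eventuallyEq ?_ h4
        refine h3.congr_deriv ?_
        rw [hKH _ h0]
        simp only [Function.comp, Pi.pow_apply, id]
        field_simp
        norm_num
        ring
      have h5 := (hY' r).mul ((hKd.comp r (hY' r)).sqrt (hKpos _).ne')
      refine h5.congr_deriv ?_
      have := Real.sqrt_pos.2 (hKpos (Y r))
      simp only [Function.comp]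
      field_simp
      rw [Real.sq_sqrt (hKpos _).le]
      ring

/-! ### Radial barriers that become large within a fixed radius -/

/-- The Keller–Osserman condition at `+∞` for a function on the positive half-line. -/
def KellerOsserman (h : ℝ → ℝ) : Prop :=
  IntegrableOn (fun s : ℝ => (∫ t in (1 : ℝ)..s, h t) ^ (-(1 / 2) : ℝ)) (Ioi 2)

theorem intervalIntegrable_of_continuousOn_pos {h : ℝ → ℝ} (hc : ContinuousOn h (Ioi 0)) {s t : ℝ}
    (hs : 0 < s) (ht : 0 < t) : IntervalIntegrable h volume s t :=
  (hc.mono fun _ hx => (lt_min hs ht).trans_le hx.1).intervalIntegrable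

theorem hasDerivAt_integral_of_continuousOn_pos {h : ℝ → ℝ} (hc : ContinuousOn h (Ioi 0))
    {s t : ℝ} (hs : 0 < s) (ht : 0 < t) : HasDerivAt (fun x => ∫ y in s..x, h y) (h t) t :=
  intervalIntegral.integral_hasDerivAt_right (intervalIntegrable_of_continuousOn_pos hc hs ht)
    (hc.stronglyMeasurableAtFilter isOpen_Ioi t ht) (hc.continuousAt (Ioi_mem_nhds ht))

theorem integral_pos_of_pos_on {h : ℝ → ℝ} (hc : ContinuousOn h (Ioi 0))
    (hp : ∀ s, 0 < s → 0 < h s) {s : ℝ} (hs : 1 < s) : 0 < ∫ t in (1 : ℝ)..s, h t :=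
  intervalIntegral.intervalIntegral_pos_of_pos_on
    (intervalIntegrable_of_continuousOn_pos hc one_pos (one_pos.trans hs))
    (fun x hx => hp x (one_pos.trans hx.1)) hs

theorem continuousOn_kellerOsserman_integrand {h : ℝ → ℝ} (hc : ContinuousOn h (Ioi 0))
    (hp : ∀ s, 0 < s → 0 < h s) :
    ContinuousOn (fun s : ℝ => (∫ t in (1 : ℝ)..s, h t) ^ (-(1 / 2) : ℝ)) (Ioi 1) := by
  intro s hs
  have hs' : (1 : ℝ) < s := hs
  exact ((hasDerivAt_integral_of_continuousOn_pos hc one_pos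
    (one_pos.trans hs')).continuousAt.rpow_const
    (Or.inl (integral_pos_of_pos_on hc hp hs).ne')).continuousWithinAt

/-- For a solution of `φ'' = G(φ)`, `φ(0) = a`, `φ'(0) = 0`: elementary consequences on `[0, ∞)`. -/
theorem second_order_solution_bounds {G φ φ₁ : ℝ → ℝ} (hG : Continuous G) (hGm : Monotone G)
    {m a : ℝ} (hm : 0 < m) (hl : ∀ s, m ≤ G s) (h0 : φ 0 = a) (h1 : φ₁ 0 = 0)
    (hφ : ∀ r, HasDerivAt φ (φ₁ r) r) (hφ₁ : ∀ r, HasDerivAt φ₁ (G (φ r)) r) :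
    (∀ r, 0 ≤ r → 0 ≤ φ₁ r ∧ a + m * r ^ 2 / 2 ≤ φ r ∧ φ₁ r ≤ r * G (φ r)) ∧
      MonotoneOn φ (Ici 0) ∧ ∀ r, φ₁ r ^ 2 = 2 * ∫ s in a..φ r, G s := by
  have hA : Monotone fun r => φ₁ r - m * r := by
    have hd : ∀ r, HasDerivAt (fun r => φ₁ r - m * r) (G (φ r) - m) r := fun r => by
      exact ((hφ₁ r).sub ((hasDerivAt_id r).const_mul m)).congr_deriv (by simp)
    exact monotone_of_deriv_nonneg (fun r => (hd r).differentiableAt) fun r => by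
      rw [(hd r).deriv]; linarith [hl (φ r)]
  have hlow : ∀ r, 0 ≤ r → m * r ≤ φ₁ r := fun r hr => by
    have := hA hr
    simp only [h1] at this; linarith
  have hpos : ∀ r, 0 ≤ r → 0 ≤ φ₁ r := fun r hr => (by positivity : 0 ≤ m * r).trans (hlow r hr)
  have hmono : MonotoneOn φ (Ici 0) := by
    refine monotoneOn_of_deriv_nonneg (convex_Ici 0)
      (fun r _ => (hφ r).continuousAt.continuousWithinAt)
      (fun r _ => (hφ r).differentiableAt.differentiableWithinAt) fun r hr => ?_
    rw [(hφ r).deriv]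
    exact hpos r (interior_subset hr)
  refine ⟨fun r hr => ⟨hpos r hr, ?_, ?_⟩, hmono, ?_⟩
  · have hd : ∀ r, HasDerivAt (fun r => φ r - m * r ^ 2 / 2) (φ₁ r - m * r) r := fun r => by
      refine ((hφ r).sub ((((hasDerivAt_id r).pow 2).const_mul m).div_const 2)).congr_deriv ?_
      norm_num; ring
    have : MonotoneOn (fun r => φ r - m * r ^ 2 / 2) (Ici 0) := by
      refine monotoneOn_of_deriv_nonneg (convex_Ici 0)
        (fun r _ => (hd r).continuousAt.continuousWithinAt)
        (fun r _ => (hd r).differentiableAt.differentiableWithinAt) fun r hr => ?_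
      rw [(hd r).deriv]
      linarith [hlow r (interior_subset hr)]
    have := this self_mem_Ici hr hr
    simp only [h0] at this
    linarith
  · rcases hr.eq_or_lt with rfl | hr
    · simp [h1]
    -- By the mean value theorem `φ'(r) = r G(φ(c))` with `c < r`, and both `G` and `φ` are
    -- non-decreasing.
    obtain ⟨c, hc, hce⟩ := exists_hasDerivAt_eq_slope φ₁ (fun r => G (φ r)) hr
      (fun r _ => (hφ₁ r).continuousAt.continuousWithinAt) fun r _ => hφ₁ r
    rw [h1, sub_zero, sub_zero, eq_div_iff hr.ne'] at hce
    rw [← hce, mul_comm]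
    exact mul_le_mul_of_nonneg_left (hGm (hmono hc.1.le hr.le hc.2.le)) hr.le
  · have hd : ∀ r, HasDerivAt (fun r => φ₁ r ^ 2 - 2 * ∫ s in a..φ r, G s) 0 r := fun r => by
      have e := (((hφ₁ r).pow 2).sub
        (((hG.integral_hasStrictDerivAt a (φ r)).hasDerivAt.comp r (hφ r)).const_mul 2))
      refine e.congr_deriv ?_
      norm_num; ring
    intro r
    have := is_const_of_deriv_eq_zero (fun r => (hd r).differentiableAt) (fun r => (hd r).deriv) r 0
    simp [h0, h1] at this
    linarith

theorem exists_radius_of_kellerOsserman {h : ℝ → ℝ} (hc : ContinuousOn h (Ioi 0))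
    (hmono : MonotoneOn h (Ioi 0)) (hp : ∀ s, 0 < s → 0 < h s) (hKO : KellerOsserman h)
    {a c : ℝ} (ha : 0 < a) (ha1 : a < 1) (hc0 : 0 < c) :
    ∃ R, 0 < R ∧ ∀ M, 2 ≤ M → ∃ G φ φ₁ : ℝ → ℝ, Continuous G ∧
      (∀ s ∈ Icc a M, G s = c * h s) ∧ φ 0 = a ∧ φ₁ 0 = 0 ∧
      (∀ r, HasDerivAt φ (φ₁ r) r) ∧ (∀ r, HasDerivAt φ₁ (G (φ r)) r) ∧
      (∀ r, 0 ≤ r → a ≤ φ r ∧ φ₁ r ≤ r * G (φ r)) ∧ M ≤ φ R := by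
  set P : ℝ → ℝ := fun s => (∫ t in (1 : ℝ)..s, h t) ^ (-(1 / 2) : ℝ) with hP
  have hPc : ContinuousOn P (Ioi 1) := continuousOn_kellerOsserman_integrand hc hp
  have hPpos : ∀ s, 1 < s → 0 < P s := fun s hs =>
    Real.rpow_pos_of_pos (integral_pos_of_pos_on hc hp hs) _
  have hPi : IntegrableOn P (Ioi 2) := hKO
  set I := ∫ s in Ioi 2, P s with hI
  have hI0 : 0 ≤ I := setIntegral_nonneg measurableSet_Ioi fun s hs =>
    (hPpos s (by have : (2 : ℝ) < s := hs; linarith)).le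
  have hm : 0 < c * h a := mul_pos hc0 (hp a ha)
  -- Chosen so that `c h(a) r₀² / 2 = 2`: the quadratic lower bound then gives `φ ≥ 2` from `r₀` on,
  -- inside the range of the Keller–Osserman integral.
  set r₀ := √(4 / (c * h a)) with hr₀
  have hr₀p : 0 < r₀ := Real.sqrt_pos.2 (by positivity)
  have h2c : 0 < √(2 * c) := Real.sqrt_pos.2 (by positivity)
  -- The radius is fixed before `M`. After `r₀`, the quantity `∫_2^φ P ≤ I` grows at rate at least
  -- `√(2c)` while `φ < M`; the extra 1 makes the final contradiction strict.
  refine ⟨r₀ + (I + 1) / √(2 * c), by positivity, fun M hM => ?_⟩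
  set R := r₀ + (I + 1) / √(2 * c) with hR
  have hr₀R : r₀ ≤ R := by rw [hR]; linarith [(by positivity : 0 ≤ (I + 1) / √(2 * c))]
  have haM : a ≤ M := by linarith
  -- Clamping the argument of `h` to `[a, M]` makes the nonlinearity bounded and bounded away from
  -- 0, so the solution is global.
  have hcl : ∀ s, a ≤ max a (min s M) ∧ max a (min s M) ≤ M := fun s =>
    ⟨le_max_left _ _, max_le haM (min_le_right _ _)⟩
  have hGc : Continuous fun s => c * h (max a (min s M)) := by
    refine continuous_const.mul (hc.comp_continuous (by fun_prop) fun s => ?_)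
    exact ha.trans_le (hcl s).1
  have hGm : Monotone fun s => c * h (max a (min s M)) := fun s t hst =>
    mul_le_mul_of_nonneg_left (hmono (ha.trans_le (hcl s).1) (ha.trans_le (hcl t).1)
      (max_le_max le_rfl (min_le_min hst le_rfl))) hc0.le
  have hGl : ∀ s, c * h a ≤ c * h (max a (min s M)) := fun s =>
    mul_le_mul_of_nonneg_left (hmono ha (ha.trans_le (hcl s).1) (hcl s).1) hc0.le
  have hGe : ∀ s ∈ Icc a M, c * h (max a (min s M)) = c * h s := fun s hs => by
    rw [min_eq_left hs.2, max_eq_right hs.1]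
  obtain ⟨φ, φ₁, h0, h1, hφ, hφ₁⟩ := exists_second_order_solution hGc hm hGl (L := c * h M)
    (fun s => mul_le_mul_of_nonneg_left (hmono (ha.trans_le (hcl s).1) (ha.trans_le haM)
      (hcl s).2) hc0.le) a
  obtain ⟨hb, hφm, hen⟩ := second_order_solution_bounds hGc hGm hm hGl h0 h1 hφ hφ₁
  refine ⟨_, φ, φ₁, hGc, hGe, h0, h1, hφ, hφ₁, fun r hr => ⟨?_, (hb r hr).2.2⟩, ?_⟩
  · have := (hb r hr).2.1
    have : 0 ≤ c * h a * r ^ 2 / 2 := by positivity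
    linarith
  by_contra! hlt
  have hφ2 : ∀ r, r₀ ≤ r → 2 ≤ φ r := fun r hr => by
    have h3 := (hb r₀ hr₀p.le).2.1
    have h4 : c * h a * r₀ ^ 2 / 2 = 2 := by
      rw [hr₀, Real.sq_sqrt (by positivity)]
      have := hp a ha
      field_simp
      norm_num
    linarith [hφm hr₀p.le (hr₀p.le.trans hr) hr]
  have hφM : ∀ r, 0 ≤ r → r ≤ R → φ r < M := fun r hr hrR =>
    (hφm hr (hr.trans hrR) hrR).trans_lt hlt
  -- Energy conservation, dropping the part of the integral over `[a, 1]`; the clamp is inactive on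
  -- `[1, φ r]` because `φ r < M`.
  have hspeed : ∀ r, r₀ ≤ r → r ≤ R → √(2 * c) ≤ P (φ r) * φ₁ r := fun r hr hrR => by
    have h2 := hφ2 r hr
    have hJ := integral_pos_of_pos_on hc hp (s := φ r) (by linarith)
    have e1 : c * (∫ t in (1 : ℝ)..φ r, h t) ≤ ∫ s in a..φ r, c * h (max a (min s M)) := by
      rw [← intervalIntegral.integral_add_adjacent_intervals (hGc.intervalIntegrable a 1)
        (hGc.intervalIntegrable 1 (φ r))]
      have e2 : 0 ≤ ∫ s in a..1, c * h (max a (min s M)) :=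
        intervalIntegral.integral_nonneg ha1.le fun s _ => hm.le.trans (hGl s)
      have e3 : ∫ s in (1 : ℝ)..φ r, c * h (max a (min s M)) = c * (∫ t in (1 : ℝ)..φ r, h t) := by
        rw [← intervalIntegral.integral_const_mul]
        refine intervalIntegral.integral_congr fun s hs => ?_
        rw [uIcc_of_le (by linarith)] at hs
        exact hGe s ⟨ha1.le.trans hs.1, hs.2.trans (hφM r (hr₀p.le.trans hr) hrR).le⟩
      linarith
    have e4 : √(2 * c) * √(∫ t in (1 : ℝ)..φ r, h t) ≤ φ₁ r := by
      rw [← Real.sqrt_mul (by positivity), ← Real.sqrt_sq (hb r (hr₀p.le.trans hr)).1]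
      refine Real.sqrt_le_sqrt ?_
      rw [hen]; linarith
    have e5 : P (φ r) = (√(∫ t in (1 : ℝ)..φ r, h t))⁻¹ := by
      rw [hP, Real.sqrt_eq_rpow, ← Real.rpow_neg hJ.le]
    have := Real.sqrt_pos.2 hJ
    rw [e5, inv_mul_eq_div, le_div_iff₀ this]
    exact e4
  have hPint : ∀ s, 2 ≤ s → IntervalIntegrable P volume 2 s := fun s hs =>
    (hPc.mono fun x hx => by
      rw [uIcc_of_le hs] at hx; exact lt_of_lt_of_le one_lt_two hx.1).intervalIntegrable
  have hQ : ∀ s, 2 ≤ s → HasDerivAt (fun x => ∫ t in (2 : ℝ)..x, P t) (P s) s := fun s hs =>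
    intervalIntegral.integral_hasDerivAt_right (hPint s hs)
      (hPc.stronglyMeasurableAtFilter isOpen_Ioi s (by have : (1 : ℝ) < s := by linarith
                                                       exact this))
      (hPc.continuousAt (Ioi_mem_nhds (by linarith)))
  have hd : ∀ r, r₀ ≤ r → HasDerivAt (fun r => (∫ t in (2 : ℝ)..φ r, P t) - √(2 * c) * r)
      (P (φ r) * φ₁ r - √(2 * c)) r := fun r hr => by
    exact (((hQ _ (hφ2 r hr)).comp r (hφ r)).sub
      ((hasDerivAt_id r).const_mul (√(2 * c)))).congr_deriv (by simp)
  have hmon : MonotoneOn (fun r => (∫ t in (2 : ℝ)..φ r, P t) - √(2 * c) * r) (Icc r₀ R) := by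
    refine monotoneOn_of_deriv_nonneg (convex_Icc _ _)
      (fun r hr => (hd r hr.1).continuousAt.continuousWithinAt)
      (fun r hr => (hd r (interior_subset hr).1).differentiableAt.differentiableWithinAt)
      fun r hr => ?_
    have hr := interior_subset hr
    rw [(hd r hr.1).deriv]
    linarith [hspeed r hr.1 hr.2]
  have hfin := hmon (left_mem_Icc.2 hr₀R) (right_mem_Icc.2 hr₀R) hr₀R
  have f1 : 0 ≤ ∫ t in (2 : ℝ)..φ r₀, P t :=
    intervalIntegral.integral_nonneg (hφ2 _ le_rfl) fun s hs => (hPpos s (by linarith [hs.1])).le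
  have f2 : ∫ t in (2 : ℝ)..φ R, P t ≤ I := by
    rw [intervalIntegral.integral_of_le (hφ2 _ hr₀R)]
    refine setIntegral_mono_set hPi ?_ Ioc_subset_Ioi_self.eventuallyLE
    filter_upwards [ae_restrict_mem measurableSet_Ioi] with s hs
    exact (hPpos s (by have : (2 : ℝ) < s := hs; linarith)).le
  have f3 : √(2 * c) * R = √(2 * c) * r₀ + (I + 1) := by
    rw [hR]; field_simp
  simp only at hfin
  linarith

/-! ### Divergence theorem and calculus of radial functions -/

theorem inner_gradient_eq_fderiv {E : Type*} [NormedAddCommGroup E] [InnerProductSpace ℝ E]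
    [CompleteSpace E] (ψ : E → ℝ) (x v : E) : inner ℝ v (gradient ψ x) = fderiv ℝ ψ x v := by
  rw [real_inner_comm, gradient, InnerProductSpace.toDual_symm_apply]

/-- The divergence theorem for compactly supported test functions, for a differentiable vector field
whose derivative is locally bounded. -/
theorem integral_inner_gradient_eq_neg_integral_divergence {N : ℕ}
    {X : EuclideanSpace ℝ (Fin N) → EuclideanSpace ℝ (Fin N)} (hX : Differentiable ℝ X)
    {B : EuclideanSpace ℝ (Fin N) → ℝ} (hB : Continuous B) (hXB : ∀ x, ‖fderiv ℝ X x‖ ≤ B x)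
    {ψ : EuclideanSpace ℝ (Fin N) → ℝ} (hψ : ContDiff ℝ 1 ψ) (hs : HasCompactSupport ψ) :
    Integrable (fun x => (∑ i, fderiv ℝ X x (EuclideanSpace.single i 1) i) * ψ x) ∧
    ∫ x, inner ℝ (X x) (gradient ψ x) =
      -∫ x, (∑ i, fderiv ℝ X x (EuclideanSpace.single i 1) i) * ψ x := by
  have hXi : ∀ i x, HasFDerivAt (fun x => X x i)
      ((EuclideanSpace.proj i : EuclideanSpace ℝ (Fin N) →L[ℝ] ℝ).comp (fderiv ℝ X x)) x :=
    fun i x => (EuclideanSpace.proj i : EuclideanSpace ℝ (Fin N) →L[ℝ] ℝ).hasFDerivAt.comp x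
      (hX x).hasFDerivAt
  have hXe : ∀ i x, fderiv ℝ X x (EuclideanSpace.single i 1) i =
      fderiv ℝ (fun x => X x i) x (EuclideanSpace.single i 1) := fun i x => by
    rw [(hXi i x).fderiv]; rfl
  have hψc : Continuous ψ := hψ.continuous
  have hdψ : ∀ v, Continuous fun x => fderiv ℝ ψ x v := fun v =>
    (hψ.continuous_fderiv one_ne_zero).clm_apply continuous_const
  have hXc : ∀ i, Continuous fun x => X x i := fun i =>
    continuous_iff_continuousAt.2 fun x => (hXi i x).continuousAt
  have hi1 : ∀ i, Integrable fun x =>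
      fderiv ℝ (fun x => X x i) x (EuclideanSpace.single i 1) * ψ x := fun i => by
    have hBi : Integrable fun x => B x * ‖ψ x‖ :=
      (hB.mul hψc.norm).integrable_of_hasCompactSupport (hs.norm.mul_left)
    refine hBi.mono' ((measurable_fderiv_apply_const ℝ _ _).aestronglyMeasurable.mul
      hψc.aestronglyMeasurable) (Filter.Eventually.of_forall fun x => ?_)
    rw [norm_mul]
    refine mul_le_mul_of_nonneg_right ?_ (norm_nonneg _)
    rw [← hXe]
    refine (PiLp.norm_apply_le _ i).trans (((fderiv ℝ X x).le_opNorm _).trans ?_)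
    simpa using hXB x
  have hi2 : ∀ i, Integrable fun x => X x i * fderiv ℝ ψ x (EuclideanSpace.single i 1) :=
    fun i => ((hXc i).mul (hdψ _)).integrable_of_hasCompactSupport
      ((hs.fderiv_apply ℝ _).mul_left)
  have hi3 : ∀ i, Integrable fun x => X x i * ψ x := fun i =>
    ((hXc i).mul hψc).integrable_of_hasCompactSupport hs.mul_left
  simp only [hXe, Finset.sum_mul]
  refine ⟨integrable_finsetSum _ fun i _ => hi1 i, ?_⟩
  rw [integral_finsetSum _ fun i _ => hi1 i, ← Finset.sum_neg_distrib]
  have hip : ∀ x, inner ℝ (X x) (gradient ψ x) =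
      ∑ i, X x i * fderiv ℝ ψ x (EuclideanSpace.single i 1) := fun x => by
    rw [inner_gradient_eq_fderiv]
    conv_lhs => rw [← (EuclideanSpace.basisFun (Fin N) ℝ).sum_repr (X x)]
    simp
  simp only [hip]
  rw [integral_finsetSum _ fun i _ => hi2 i]
  refine Finset.sum_congr rfl fun i _ => ?_
  exact integral_mul_fderiv_eq_neg_fderiv_mul_of_integrable (hi1 i) (hi2 i) (hi3 i)
    (fun x _ => (hXi i x).differentiableAt) (fun x _ => (hψ.differentiable one_ne_zero) x)

section Radial

variable {E : Type*} [NormedAddCommGroup E] [InnerProductSpace ℝ E]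

theorem hasFDerivAt_norm_sub {x₀ x : E} (hx : x ≠ x₀) :
    HasFDerivAt (fun x => ‖x - x₀‖) (‖x - x₀‖⁻¹ • innerSL ℝ (x - x₀)) x := by
  have hp : 0 < ‖x - x₀‖ := norm_pos_iff.2 (sub_ne_zero.2 hx)
  have h1 : HasFDerivAt (fun x => ‖x - x₀‖ ^ 2) (2 • innerSL ℝ (x - x₀)) x := by
    have := ((hasFDerivAt_id x).sub_const x₀).norm_sq
    refine this.congr_fderiv ?_
    ext v; simp
  have h2 := h1.sqrt (by positivity)
  refine (h2.congr_of_eventuallyEq (Filter.Eventually.of_forall fun y => ?_)).congr_fderiv ?_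
  · simp
  · ext v; simp; ring

/-- `dslope φ₁ 0` is `φ₁(r)/r` extended by `φ₁'(0)` at 0, so one formula also covers the centre. -/
theorem hasGradientAt_radial [CompleteSpace E] {φ φ₁ : ℝ → ℝ} (h1 : φ₁ 0 = 0)
    (hφ : ∀ r, HasDerivAt φ (φ₁ r) r) (x₀ x : E) :
    HasGradientAt (fun x => φ ‖x - x₀‖) (dslope φ₁ 0 ‖x - x₀‖ • (x - x₀)) x := by
  rw [hasGradientAt_iff_hasFDerivAt]
  by_cases hx : x = x₀
  · subst hx
    have h2 := (hφ 0).hasFDerivAt.isLittleO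
    rw [hasFDerivAt_iff_isLittleO]
    have h3 : Filter.Tendsto (fun y => ‖y - x‖) (nhds x) (nhds 0) := by
      have : Continuous fun y => ‖y - x‖ := by fun_prop
      simpa using this.tendsto x
    have h4 := (h2.comp_tendsto h3)
    simp only [Function.comp_def, h1] at h4
    rw [← Asymptotics.isLittleO_norm_right]
    simpa using h4
  · have hp : 0 < ‖x - x₀‖ := norm_pos_iff.2 (sub_ne_zero.2 hx)
    refine ((hφ _).comp_hasFDerivAt x (hasFDerivAt_norm_sub hx)).congr_fderiv ?_
    ext v
    rw [dslope_of_ne _ hp.ne', slope_def_field, h1]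
    simp
    ring

/-- At the centre continuity of `k` suffices, because `x - x₀` is itself of first order. -/
theorem hasFDerivAt_radial_field {k k' : ℝ → ℝ} (hk : Continuous k)
    (hk' : ∀ r, 0 < r → HasDerivAt k (k' r) r) (x₀ x : E) :
    HasFDerivAt (fun x => k ‖x - x₀‖ • (x - x₀))
      (k ‖x - x₀‖ • ContinuousLinearMap.id ℝ E +
        (k' ‖x - x₀‖ / ‖x - x₀‖) • (innerSL ℝ (x - x₀)).smulRight (x - x₀)) x := by
  by_cases hx : x = x₀
  · subst hx
    simp only [sub_self, norm_zero, ContinuousLinearMap.smulRight_zero, smul_zero, add_zero]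
    rw [hasFDerivAt_iff_isLittleO]
    have h3 : Filter.Tendsto (fun y => k ‖y - x‖ - k 0) (nhds x) (nhds 0) := by
      have : Continuous fun y => k ‖y - x‖ - k 0 := by fun_prop
      simpa using this.tendsto x
    have h4 := ((Asymptotics.isLittleO_one_iff ℝ).2 h3).smul_isBigO
      (Asymptotics.isBigO_refl (fun y => y - x) (nhds x))
    simpa [sub_smul] using h4
  · have hp : 0 < ‖x - x₀‖ := norm_pos_iff.2 (sub_ne_zero.2 hx)
    refine (((hk' _ hp).comp_hasFDerivAt x (hasFDerivAt_norm_sub hx)).smul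
      ((hasFDerivAt_id x).sub_const x₀)).congr_fderiv ?_
    ext v
    simp [smul_smul, div_eq_mul_inv]

end Radial

/-! ### Squared positive parts as `C¹` test functions -/

theorem hasDerivAt_posPart_sq (t : ℝ) :
    HasDerivAt (fun t : ℝ => (max t 0) ^ 2) (2 * max t 0) t := by
  rcases lt_trichotomy t 0 with ht | rfl | ht
  · rw [max_eq_right ht.le, mul_zero]
    refine (hasDerivAt_const t (0 : ℝ)).congr_of_eventuallyEq ?_
    filter_upwards [Iio_mem_nhds ht] with s hs
    rw [max_eq_right (le_of_lt hs)]; simp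
  · rw [hasDerivAt_iff_tendsto_slope]
    -- The difference quotient of the squared positive part at 0 is the positive part itself,
    -- written here as a difference.
    have : Continuous fun s : ℝ => 2 * max s 0 - max s 0 := by fun_prop
    have h2 := (this.tendsto 0).mono_left (nhdsWithin_le_nhds (s := {0}ᶜ))
    simp only [max_self, mul_zero, sub_zero] at h2 ⊢
    refine h2.congr' ?_
    filter_upwards [self_mem_nhdsWithin] with s hs
    have hs : s ≠ 0 := hs
    rw [slope_def_field]
    rcases lt_or_gt_of_ne hs with h | h
    · simp [max_eq_right h.le]
    · simp only [max_eq_left h.le, max_self]; field_simp; ring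
  · rw [max_eq_left ht.le]
    have h1 : HasDerivAt (fun t : ℝ => t ^ 2) (2 * t) t := by simpa using hasDerivAt_pow 2 t
    refine h1.congr_of_eventuallyEq ?_
    filter_upwards [Ioi_mem_nhds ht] with s hs
    rw [max_eq_left (le_of_lt hs)]

/-- The square of the positive part of a `C¹` function, cut off outside a set on whose frontier the
function is negative. -/
theorem hasFDerivAt_indicator_posPart_sq {E : Type*} [NormedAddCommGroup E] [NormedSpace ℝ E]
    {D : E → ℝ} (hD : ContDiff ℝ 1 D) {U : Set E} (hU : ∀ x ∈ frontier U, D x < 0) (x : E) :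
    HasFDerivAt (U.indicator fun x => (max (D x) 0) ^ 2)
      (U.indicator (fun x => (2 * max (D x) 0) • fderiv ℝ D x) x) x := by
  have hd : HasFDerivAt (fun x => (max (D x) 0) ^ 2) ((2 * max (D x) 0) • fderiv ℝ D x) x :=
    (hasDerivAt_posPart_sq (D x)).comp_hasFDerivAt x
      ((hD.differentiable one_ne_zero) x).hasFDerivAt
  by_cases h1 : x ∈ interior U
  · rw [indicator_of_mem (interior_subset h1)]
    refine hd.congr_of_eventuallyEq ?_
    filter_upwards [isOpen_interior.mem_nhds h1] with y hy
    rw [indicator_of_mem (interior_subset hy)]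
  by_cases h2 : x ∈ closure U
  · have h3 := hU x ⟨h2, h1⟩
    have h4 : U.indicator (fun x => (2 * max (D x) 0) • fderiv ℝ D x) x = 0 := by
      by_cases hx : x ∈ U
      · rw [indicator_of_mem hx, max_eq_right h3.le]; simp
      · rw [indicator_of_notMem hx]
    rw [h4]
    refine (hasFDerivAt_const (0 : ℝ) x).congr_of_eventuallyEq ?_
    filter_upwards [hD.continuous.continuousAt.eventually (Iio_mem_nhds h3)] with y hy
    by_cases hx : y ∈ U
    · rw [indicator_of_mem hx, max_eq_right (le_of_lt hy)]; simp
    · rw [indicator_of_notMem hx]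
  · rw [indicator_of_notMem fun hx => h2 (subset_closure hx)]
    refine (hasFDerivAt_const (0 : ℝ) x).congr_of_eventuallyEq ?_
    filter_upwards [isClosed_closure.isOpen_compl.mem_nhds h2] with y hy
    rw [indicator_of_notMem fun hx => hy (subset_closure hx)]

theorem contDiff_indicator_posPart_sq {E : Type*} [NormedAddCommGroup E] [NormedSpace ℝ E]
    {D : E → ℝ} (hD : ContDiff ℝ 1 D) {U : Set E} (hU : ∀ x ∈ frontier U, D x < 0) :
    ContDiff ℝ 1 (U.indicator fun x => (max (D x) 0) ^ 2) := by
  rw [contDiff_one_iff_hasFDerivAt]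
  refine ⟨_, ?_, hasFDerivAt_indicator_posPart_sq hD hU⟩
  refine continuous_indicator (fun a ha => by rw [max_eq_right (hU a ha).le]; simp) ?_
  exact (((continuous_const.mul (hD.continuous.max continuous_const))).smul
    (hD.continuous_fderiv one_ne_zero)).continuousOn

/-! ### Weak Laplacian of a radial function -/

theorem contDiff_radial {E : Type*} [NormedAddCommGroup E] [InnerProductSpace ℝ E]
    [CompleteSpace E] {φ φ₁ g : ℝ → ℝ} (h1 : φ₁ 0 = 0)
    (hφ : ∀ r, HasDerivAt φ (φ₁ r) r) (hφ₁ : ∀ r, HasDerivAt φ₁ (g r) r) (x₀ : E) :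
    ContDiff ℝ 1 fun x => φ ‖x - x₀‖ := by
  have hk : Continuous (dslope φ₁ 0) := by
    rw [← continuousOn_univ, continuousOn_dslope Filter.univ_mem]
    exact ⟨fun r _ => (hφ₁ r).continuousAt.continuousWithinAt, (hφ₁ 0).differentiableAt⟩
  rw [contDiff_one_iff_hasFDerivAt]
  refine ⟨_, ?_, fun x => (hasGradientAt_radial h1 hφ x₀ x).hasFDerivAt⟩
  fun_prop

/-- A radial function `φ(|x - x₀|)` with `φ' ≤ r φ''` satisfies `Δ ≤ N φ''` in the weak sense. -/
theorem neg_integral_le_integral_inner_gradient_radial {N : ℕ} (hN : 1 ≤ N) {φ φ₁ g : ℝ → ℝ}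
    (h1 : φ₁ 0 = 0) (hg : Continuous g)
    (hφ : ∀ r, HasDerivAt φ (φ₁ r) r) (hφ₁ : ∀ r, HasDerivAt φ₁ (g r) r)
    (hle : ∀ r, 0 ≤ r → φ₁ r ≤ r * g r) (x₀ : EuclideanSpace ℝ (Fin N))
    {ψ : EuclideanSpace ℝ (Fin N) → ℝ} (hψ : ContDiff ℝ 1 ψ) (hs : HasCompactSupport ψ)
    (hψ0 : ∀ x, 0 ≤ ψ x) :
    -∫ x, N * g ‖x - x₀‖ * ψ x ≤
      ∫ x, inner ℝ (gradient (fun x => φ ‖x - x₀‖) x) (gradient ψ x) := by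
  have hk : Continuous (dslope φ₁ 0) := by
    rw [← continuousOn_univ, continuousOn_dslope Filter.univ_mem]
    exact ⟨fun r _ => (hφ₁ r).continuousAt.continuousWithinAt, (hφ₁ 0).differentiableAt⟩
  have hke : ∀ r, r ≠ 0 → dslope φ₁ 0 r = φ₁ r / r := fun r hr => by
    rw [dslope_of_ne _ hr, slope_def_field, h1]; simp
  set k := dslope φ₁ 0 with hkdef
  have hk0 : k 0 = g 0 := by rw [hkdef, dslope_same, (hφ₁ 0).deriv]
  have hk' : ∀ r, 0 < r → HasDerivAt k ((g r - k r) / r) r := fun r hr => by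
    have e := (hφ₁ r).div (hasDerivAt_id r) hr.ne'
    refine (e.congr_of_eventuallyEq ?_).congr_deriv ?_
    · filter_upwards [isOpen_ne.mem_nhds hr.ne'] with s hs using hke s hs
    · rw [hke r hr.ne']
      simp only [id]
      field_simp
  have hX := fun x => hasFDerivAt_radial_field hk hk' x₀ x
  have hnorm : ∀ x, ‖fderiv ℝ (fun x => k ‖x - x₀‖ • (x - x₀)) x‖ ≤
      |k ‖x - x₀‖| + |g ‖x - x₀‖ - k ‖x - x₀‖| := fun x => by
    rw [(hX x).fderiv]
    refine (norm_add_le _ _).trans (add_le_add ?_ ?_)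
    · rw [norm_smul, Real.norm_eq_abs]
      exact mul_le_of_le_one_right (abs_nonneg _) ContinuousLinearMap.norm_id_le
    · rw [norm_smul, ContinuousLinearMap.norm_smulRight_apply, innerSL_apply_norm,
        Real.norm_eq_abs, abs_div, abs_div, abs_norm]
      rcases (norm_nonneg (x - x₀)).eq_or_lt with h | h
      · rw [← h]; simp
      · field_simp; rfl
  -- The divergence is `N k + (g - k) = (N - 1) φ'/r + φ''`, and `k = φ'/r ≤ g`.
  have hdiv : ∀ x, ∑ i, fderiv ℝ (fun x => k ‖x - x₀‖ • (x - x₀)) x (EuclideanSpace.single i 1) i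
      ≤ N * g ‖x - x₀‖ := fun x => by
    have e : ∑ i, fderiv ℝ (fun x => k ‖x - x₀‖ • (x - x₀)) x (EuclideanSpace.single i 1) i =
        N * k ‖x - x₀‖ + (g ‖x - x₀‖ - k ‖x - x₀‖) / ‖x - x₀‖ / ‖x - x₀‖ * ‖x - x₀‖ ^ 2 := by
      rw [(hX x).fderiv, EuclideanSpace.norm_sq_eq (x - x₀), Finset.mul_sum]
      simp [Finset.sum_add_distrib, EuclideanSpace.inner_single_right]
      refine Finset.sum_congr rfl fun i _ => ?_
      ring
    rw [e]
    rcases (norm_nonneg (x - x₀)).eq_or_lt with h | h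
    · rw [← h, hk0]; simp
    · have h3 : k ‖x - x₀‖ ≤ g ‖x - x₀‖ := by
        rw [hke _ h.ne', div_le_iff₀ h, mul_comm]; exact hle _ h.le
      have h4 : (g ‖x - x₀‖ - k ‖x - x₀‖) / ‖x - x₀‖ / ‖x - x₀‖ * ‖x - x₀‖ ^ 2 =
        g ‖x - x₀‖ - k ‖x - x₀‖ := by field_simp
      rw [h4]
      have h5 : (1 : ℝ) ≤ N := by exact_mod_cast hN
      nlinarith
  obtain ⟨hi, he⟩ := integral_inner_gradient_eq_neg_integral_divergence
    (fun x => (hX x).differentiableAt) (B := fun x => |k ‖x - x₀‖| + |g ‖x - x₀‖ - k ‖x - x₀‖|)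
    (by fun_prop) hnorm hψ hs
  have hgr : ∀ x, gradient (fun x => φ ‖x - x₀‖) x = k ‖x - x₀‖ • (x - x₀) := fun x =>
    (hasGradientAt_radial h1 hφ x₀ x).gradient
  simp only [hgr]
  rw [he]
  refine neg_le_neg (integral_mono hi ?_ fun x => mul_le_mul_of_nonneg_right (hdiv x) (hψ0 x))
  refine Continuous.integrable_of_hasCompactSupport ?_ hs.mul_left
  have := hψ.continuous
  fun_prop

/-! ### Comparison principle and Keller–Osserman nonexistence -/

/-- `-Δ v ≥ F` in the weak sense, with nonnegative compactly supported `C¹` test functions. -/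
def IsWeakSupersolution {N : ℕ} (v F : EuclideanSpace ℝ (Fin N) → ℝ) : Prop :=
  ∀ ψ : EuclideanSpace ℝ (Fin N) → ℝ, ContDiff ℝ 1 ψ → HasCompactSupport ψ → (∀ x, 0 ≤ ψ x) →
    ∫ x, F x * ψ x ≤ ∫ x, inner ℝ (gradient v x) (gradient ψ x)

theorem continuous_gradient {E : Type*} [NormedAddCommGroup E] [InnerProductSpace ℝ E]
    [CompleteSpace E] {v : E → ℝ} (hv : ContDiff ℝ 1 v) : Continuous (gradient v) :=
  (InnerProductSpace.toDual ℝ E).symm.continuous.comp (hv.continuous_fderiv one_ne_zero)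

theorem hasCompactSupport_inner_gradient {E : Type*} [NormedAddCommGroup E]
    [InnerProductSpace ℝ E] [CompleteSpace E] {X : E → E} {ψ : E → ℝ} (hs : HasCompactSupport ψ) :
    HasCompactSupport fun x => inner ℝ (X x) (gradient ψ x) :=
  (hs.fderiv ℝ).mono' fun x hx => subset_tsupport _ fun h0 => hx (by
    simp only
    rw [inner_gradient_eq_fderiv, h0]; rfl)

/-- Comparison principle on a ball. -/
theorem neg_le_of_isWeakSupersolution {N : ℕ} (hN : 1 ≤ N)
    {v z F H : EuclideanSpace ℝ (Fin N) → ℝ} (hv : ContDiff ℝ 1 v) (hz : ContDiff ℝ 1 z)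
    (hF : Continuous F) (hH : Continuous H) (hvF : IsWeakSupersolution v F)
    (hzH : IsWeakSupersolution z fun x => -H x) {x₀ : EuclideanSpace ℝ (Fin N)} {R : ℝ}
    (hR : 0 < R) (hbd : ∀ x, ‖x - x₀‖ = R → -v x < z x)
    (hHF : ∀ x, ‖x - x₀‖ < R → z x < -v x → H x ≤ F x) :
    ∀ x, ‖x - x₀‖ < R → -v x ≤ z x := by
  have hne : Nonempty (Fin N) := ⟨⟨0, hN⟩⟩
  set D : EuclideanSpace ℝ (Fin N) → ℝ := fun x => -v x - z x with hDdef
  have hD : ContDiff ℝ 1 D := hv.neg.sub hz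
  set U := Metric.ball x₀ R with hUdef
  have hU : ∀ x ∈ frontier U, D x < 0 := fun x hx => by
    rw [hUdef, frontier_ball _ hR.ne', mem_sphere_iff_norm] at hx
    have := hbd x hx
    simp only [hDdef]; linarith
  -- The positive part of `D` is only Lipschitz; its square is an admissible `C¹` test function. The
  -- strict boundary inequality lets it be cut off at the sphere.
  set ψ := U.indicator fun x => (max (D x) 0) ^ 2 with hψdef
  have hψ : ContDiff ℝ 1 ψ := contDiff_indicator_posPart_sq hD hU
  have hψ' := hasFDerivAt_indicator_posPart_sq hD hU
  have hψs : HasCompactSupport ψ := by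
    refine HasCompactSupport.intro (isCompact_closedBall x₀ R) fun x hx => ?_
    rw [hψdef, indicator_of_notMem]
    exact fun h => hx (Metric.ball_subset_closedBall h)
  have hψ0 : ∀ x, 0 ≤ ψ x := fun x => indicator_nonneg (fun _ _ => sq_nonneg _) x
  have hgD : ∀ x, gradient D x = -gradient v x - gradient z x := fun x => by
    have h1 := (hv.differentiable one_ne_zero x).hasGradientAt
    have h2 := (hz.differentiable one_ne_zero x).hasGradientAt
    rw [hasGradientAt_iff_hasFDerivAt] at h1 h2
    refine HasGradientAt.gradient ?_
    rw [hasGradientAt_iff_hasFDerivAt, map_sub, map_neg]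
    exact h1.neg.sub h2
  have hint : ∀ {w : EuclideanSpace ℝ (Fin N) → ℝ}, ContDiff ℝ 1 w →
      Integrable fun x => inner ℝ (gradient w x) (gradient ψ x) := fun hw =>
    ((continuous_gradient hw).inner (continuous_gradient hψ)).integrable_of_hasCompactSupport
      (hasCompactSupport_inner_gradient hψs)
  have hJ : ∀ x, inner ℝ (gradient D x) (gradient ψ x) =
      U.indicator (fun x => (2 * max (D x) 0) * ‖gradient D x‖ ^ 2) x := fun x => by
    rw [inner_gradient_eq_fderiv, (hψ' x).fderiv]
    by_cases hx : x ∈ U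
    · rw [indicator_of_mem hx, indicator_of_mem hx]
      simp [← inner_gradient_eq_fderiv]
    · rw [indicator_of_notMem hx, indicator_of_notMem hx]; rfl
  have hJ0 : ∀ x, 0 ≤ inner ℝ (gradient D x) (gradient ψ x) := fun x => by
    rw [hJ]; exact indicator_nonneg (fun _ _ => by positivity) x
  have hle : ∫ x, inner ℝ (gradient D x) (gradient ψ x) ≤ 0 := by
    have e : ∫ x, inner ℝ (gradient D x) (gradient ψ x) =
        -(∫ x, inner ℝ (gradient v x) (gradient ψ x)) -
          ∫ x, inner ℝ (gradient z x) (gradient ψ x) := by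
      have hn : Integrable fun x => -inner ℝ (gradient v x) (gradient ψ x) := (hint hv).neg
      rw [← integral_neg, ← integral_sub hn (hint hz)]
      congr 1; ext x
      rw [hgD, inner_sub_left, inner_neg_left]
    have h1 := hvF ψ hψ hψs hψ0
    have h2 := hzH ψ hψ hψs hψ0
    have h3 : ∫ x, H x * ψ x ≤ ∫ x, F x * ψ x := by
      refine integral_mono ((hH.mul hψ.continuous).integrable_of_hasCompactSupport hψs.mul_left)
        ((hF.mul hψ.continuous).integrable_of_hasCompactSupport hψs.mul_left) fun x => ?_
      by_cases hx : x ∈ U ∧ 0 < D x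
      · refine mul_le_mul_of_nonneg_right (hHF x (mem_ball_iff_norm.1 hx.1) ?_) (hψ0 x)
        have := hx.2
        simp only [hDdef] at this; linarith
      · have : ψ x = 0 := by
          by_cases hxU : x ∈ U
          · rw [hψdef, indicator_of_mem hxU, max_eq_right (not_lt.1 fun h => hx ⟨hxU, h⟩)]
            simp
          · rw [hψdef, indicator_of_notMem hxU]
        simp [this]
    have h4 : ∫ x, -H x * ψ x = -∫ x, H x * ψ x := by
      rw [← integral_neg]; simp
    linarith
  -- A continuous nonnegative function with integral at most 0 vanishes, so `D⁺ |∇D|² = 0` in the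
  -- ball. Hence `∇ψ = 0` everywhere, and `ψ` is constant.
  have hJz : ∀ x, inner ℝ (gradient D x) (gradient ψ x) = 0 := fun x => by
    by_contra hx
    have := ((continuous_gradient hD).inner
      (continuous_gradient hψ)).integral_pos_of_hasCompactSupport_nonneg_nonzero (μ := volume)
      (hasCompactSupport_inner_gradient hψs) hJ0 hx
    linarith
  have hdψ : ∀ x, fderiv ℝ ψ x = 0 := fun x => by
    rw [(hψ' x).fderiv]
    by_cases hxU : x ∈ U
    · have := hJz x
      rw [hJ, indicator_of_mem hxU] at this
      rw [indicator_of_mem hxU]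
      rcases mul_eq_zero.1 this with h | h
      · rw [h, zero_smul]
      · have h0 : gradient D x = 0 := by simpa using h
        have : fderiv ℝ D x = 0 := by rw [← toDual_gradient, h0, map_zero]
        rw [this, smul_zero]
    · rw [indicator_of_notMem hxU]
  intro x hx
  -- The constant is read off at a point of the sphere, which lies outside the open ball, where `ψ =
  -- 0`.
  obtain ⟨e, he⟩ := exists_norm_eq (EuclideanSpace ℝ (Fin N)) hR.le
  have hc := is_const_of_fderiv_eq_zero (hψ.differentiable one_ne_zero) hdψ x (x₀ + e)
  have h1 : ψ (x₀ + e) = 0 := by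
    rw [hψdef, indicator_of_notMem]
    rw [hUdef, mem_ball_iff_norm]; simp [he]
  rw [h1, hψdef, indicator_of_mem (mem_ball_iff_norm.2 hx)] at hc
  have h2 := max_eq_right_iff.1 (pow_eq_zero_iff two_ne_zero |>.1 hc)
  simp only [hDdef] at h2
  linarith

/-- Keller–Osserman nonexistence: an entire weak supersolution `v` of `-Δ v ≥ h(-v)` on `{v < 0}` is
nonnegative. -/
theorem nonneg_of_kellerOsserman {N : ℕ} (hN : 1 ≤ N) {v F : EuclideanSpace ℝ (Fin N) → ℝ}
    (hv : ContDiff ℝ 1 v) (hF : Continuous F) (hvF : IsWeakSupersolution v F) {h : ℝ → ℝ}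
    (hc : ContinuousOn h (Ioi 0)) (hmono : MonotoneOn h (Ioi 0)) (hp : ∀ s, 0 < s → 0 < h s)
    (hKO : KellerOsserman h) (hFh : ∀ x, v x < 0 → h (-v x) ≤ F x) (x₀) : 0 ≤ v x₀ := by
  by_contra! hneg
  have hN' : (0 : ℝ) < N := by exact_mod_cast hN
  -- The first entry gives `a < -v x₀`, for the contradiction; the second gives `a < 1`, so that the
  -- energy integral from `a` contains the one from 1.
  set a := min (-v x₀ / 2) (1 / 2) with hadef
  have ha : 0 < a := lt_min (by linarith) (by norm_num)
  have ha1 : a < 1 := (min_le_right _ _).trans_lt (by norm_num)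
  obtain ⟨R, hR, hball⟩ := exists_radius_of_kellerOsserman hc hmono hp hKO ha ha1
    (inv_pos.2 hN')
  obtain ⟨B, hB⟩ := (isCompact_closedBall x₀ R).exists_bound_of_continuousOn
    hv.continuous.continuousOn
  obtain ⟨G, φ, φ₁, hG, hGh, h0, h1, hφ, hφ₁, hle, hM⟩ := hball (max 2 (B + 1)) (le_max_left _ _)
  have hφc : Continuous φ := continuous_iff_continuousAt.2 fun r => (hφ r).continuousAt
  have hvB : ∀ x, ‖x - x₀‖ ≤ R → -v x ≤ B := fun x hx =>
    (neg_le_abs _).trans (hB x (mem_closedBall_iff_norm.2 hx))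
  have key := neg_le_of_isWeakSupersolution hN hv (contDiff_radial h1 hφ hφ₁ x₀) hF
    (H := fun x => N * G (φ ‖x - x₀‖)) (by fun_prop) hvF
    (fun ψ hψ hs hψ0 => by
      have := neg_integral_le_integral_inner_gradient_radial hN h1 (hG.comp hφc) hφ hφ₁
        (fun r hr => (hle r hr).2) x₀ hψ hs hψ0
      rw [← integral_neg] at this
      simpa using this)
    hR
    (fun x hx => by
      rw [hx]
      have := hvB x hx.le
      have := (le_max_right 2 (B + 1)).trans hM
      linarith)
    -- Where `φ < -v ≤ B < M` the truncation is inactive, so `N G(φ) = h(φ) ≤ h(-v) ≤ F`.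
    (fun x hx hlt => by
      have h2 := (hle ‖x - x₀‖ (norm_nonneg _)).1
      have h3 := hvB x hx.le
      have h4 := le_max_right 2 (B + 1)
      rw [hGh _ ⟨h2, by linarith⟩, ← mul_assoc, mul_inv_cancel₀ hN'.ne', one_mul]
      have h5 : 0 < φ ‖x - x₀‖ := by linarith
      exact (hmono h5 (h5.trans hlt) hlt.le).trans (hFh x (by linarith)))
    x₀ (by simpa using hR)
  simp only [sub_self, norm_zero, h0] at key
  have := min_le_left (-v x₀ / 2) (1 / 2)
  linarith

/-! ### Strong minimum principle -/

/-- Strong minimum principle: a nonnegative weakly superharmonic `C¹` function on `ℝ^N` that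
vanishes at one point vanishes identically. -/
theorem eq_zero_of_isWeakSupersolution {N : ℕ} {v F : EuclideanSpace ℝ (Fin N) → ℝ}
    (hv : ContDiff ℝ 1 v) (hvF : IsWeakSupersolution v F) (hF : ∀ x, 0 ≤ F x)
    (hv0 : ∀ x, 0 ≤ v x) {x₀ : EuclideanSpace ℝ (Fin N)} (hx₀ : v x₀ = 0) (x) : v x = 0 := by
  set Ψ : EuclideanSpace ℝ (Fin N) → ℝ := fun y => (max (1 - ‖y‖ ^ 2) 0) ^ 2 with hΨdef
  -- The weight is chosen so that `∇Ψ(y) = -χ(y) y`; testing with a rescaled `Ψ` then controls the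
  -- derivative of the `χ`-weighted average.
  set χ : EuclideanSpace ℝ (Fin N) → ℝ := fun y => 4 * max (1 - ‖y‖ ^ 2) 0 with hχdef
  have hχc : Continuous χ := by fun_prop
  have hχ0 : ∀ y, 0 ≤ χ y := fun y => by positivity
  have hmax : ∀ y : EuclideanSpace ℝ (Fin N), 1 ≤ ‖y‖ → max (1 - ‖y‖ ^ 2) 0 = 0 := fun y hy =>
    max_eq_right (by nlinarith)
  have hχs : HasCompactSupport χ :=
    HasCompactSupport.intro (isCompact_closedBall (0 : EuclideanSpace ℝ (Fin N)) 1) fun y hy => by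
      rw [mem_closedBall_zero_iff, not_le] at hy
      simp only [hχdef]
      rw [hmax y hy.le, mul_zero]
  have hΨ' : ∀ y, HasFDerivAt Ψ (-(χ y • innerSL ℝ y)) y := fun y => by
    have h1 : HasFDerivAt (fun y : EuclideanSpace ℝ (Fin N) => 1 - ‖y‖ ^ 2)
        (-(2 • innerSL ℝ y)) y :=
      (hasStrictFDerivAt_norm_sq y).hasFDerivAt.const_sub 1
    refine ((hasDerivAt_posPart_sq _).comp_hasFDerivAt y h1).congr_fderiv ?_
    ext w
    simp [hχdef]; ring
  have hΨ : ContDiff ℝ 1 Ψ := by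
    rw [contDiff_one_iff_hasFDerivAt]
    refine ⟨_, ?_, hΨ'⟩
    fun_prop
  have hvd : ∀ x, HasFDerivAt v (fderiv ℝ v x) x := fun x =>
    (hv.differentiable one_ne_zero x).hasFDerivAt
  have hvc := hv.continuous
  have hfd : Continuous (fderiv ℝ v) := hv.continuous_fderiv one_ne_zero
  set A : ℝ → ℝ := fun r => ∫ y, v (x₀ + r • y) * χ y with hA
  have hA' : ∀ r, HasDerivAt A (∫ y, fderiv ℝ v (x₀ + r • y) y * χ y) r := fun r => by
    obtain ⟨B, hB⟩ := (isCompact_closedBall x₀ (|r| + 1)).exists_bound_of_continuousOn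
      hfd.continuousOn
    refine (hasDerivAt_integral_of_dominated_loc_of_deriv_le (bound := fun y => B * χ y)
      (F' := fun r y => fderiv ℝ v (x₀ + r • y) y * χ y)
      (Metric.ball_mem_nhds r one_pos) (Filter.Eventually.of_forall fun s => ?_) ?_ ?_ ?_ ?_ ?_).2
    · exact Continuous.aestronglyMeasurable (by fun_prop)
    · exact Continuous.integrable_of_hasCompactSupport (by fun_prop) hχs.mul_left
    · exact Continuous.aestronglyMeasurable (by fun_prop)
    · refine Filter.Eventually.of_forall fun y s hs => ?_
      by_cases hy : 1 ≤ ‖y‖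
      · simp [hχdef, hmax y hy]
      · rw [norm_mul, Real.norm_of_nonneg (hχ0 y)]
        refine mul_le_mul_of_nonneg_right ?_ (hχ0 y)
        have hs' : |s| ≤ |r| + 1 := by
          have h1 := abs_lt.1 (mem_ball_iff_norm.1 hs)
          have h2 := abs_sub_abs_le_abs_sub s r
          have h3 : |s - r| < 1 := mem_ball_iff_norm.1 hs
          linarith
        have hmem : x₀ + s • y ∈ Metric.closedBall x₀ (|r| + 1) := by
          rw [mem_closedBall_iff_norm, add_sub_cancel_left, norm_smul, Real.norm_eq_abs]
          nlinarith [norm_nonneg y, abs_nonneg s]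
        have h4 := hB _ hmem
        exact ((fderiv ℝ v (x₀ + s • y)).le_opNorm y).trans
          (by nlinarith [norm_nonneg y, norm_nonneg (fderiv ℝ v (x₀ + s • y))])
    · exact Continuous.integrable_of_hasCompactSupport (by fun_prop) hχs.mul_left
    · refine Filter.Eventually.of_forall fun y s _ => ?_
      have h1 : HasDerivAt (fun s : ℝ => x₀ + s • y) y s := by
        exact (((hasDerivAt_id s).smul_const y).const_add x₀).congr_deriv (one_smul ℝ y)
      exact ((hvd _).comp_hasDerivAt s h1).mul_const (χ y)
  -- Test with `Ψ((x - x₀)/r)` and substitute `x = x₀ + r y`: up to a negative factor, `A'(r)` is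
  -- the nonnegative integral of `∇v · ∇ψ`.
  have hneg : ∀ r : ℝ, 0 < r → ∫ y, fderiv ℝ v (x₀ + r • y) y * χ y ≤ 0 := fun r hr => by
    have hψd : ∀ x, HasFDerivAt (fun x => Ψ (r⁻¹ • (x - x₀)))
        (r⁻¹ • fderiv ℝ Ψ (r⁻¹ • (x - x₀))) x := fun x => by
      have h1 := (hΨ.differentiable one_ne_zero (r⁻¹ • (x - x₀))).hasFDerivAt.comp x
        (((hasFDerivAt_id x).sub_const x₀).const_smul r⁻¹)
      refine h1.congr_fderiv ?_
      ext w; simp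
    have hψ : ContDiff ℝ 1 fun x => Ψ (r⁻¹ • (x - x₀)) := hΨ.comp (by fun_prop)
    have hψs : HasCompactSupport fun x => Ψ (r⁻¹ • (x - x₀)) :=
      HasCompactSupport.intro (isCompact_closedBall x₀ r) fun x hx => by
        rw [mem_closedBall_iff_norm, not_le] at hx
        simp only [hΨdef]
        rw [hmax _ _, zero_pow two_ne_zero]
        rw [norm_smul, norm_inv, Real.norm_of_nonneg hr.le, inv_mul_eq_div, le_div_iff₀ hr]
        linarith
    have h1 := hvF _ hψ hψs fun x => sq_nonneg _
    have h2 : 0 ≤ ∫ x, F x * Ψ (r⁻¹ • (x - x₀)) :=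
      integral_nonneg fun x => mul_nonneg (hF x) (sq_nonneg _)
    have h3 := h2.trans h1
    rw [← integral_add_left_eq_self _ x₀] at h3
    have h4 := Measure.integral_comp_smul (volume : Measure (EuclideanSpace ℝ (Fin N)))
      (fun x => inner ℝ (gradient v (x₀ + x)) (gradient (fun x => Ψ (r⁻¹ • (x - x₀))) (x₀ + x))) r
    have h5 : ∀ y, fderiv ℝ v (x₀ + r • y) y * χ y = -r * inner ℝ (gradient v (x₀ + r • y))
        (gradient (fun x => Ψ (r⁻¹ • (x - x₀))) (x₀ + r • y)) := fun y => by
      rw [inner_gradient_eq_fderiv, (hψd _).fderiv, add_sub_cancel_left, inv_smul_smul₀ hr.ne',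
        (hΨ' y).fderiv, ← inner_gradient_eq_fderiv, ← real_inner_comm y]
      simp
      field_simp
    simp only [h5]
    rw [integral_const_mul, h4]
    have : 0 ≤ |(r ^ Module.finrank ℝ (EuclideanSpace ℝ (Fin N)))⁻¹| • ∫ x, inner ℝ
      (gradient v (x₀ + x)) (gradient (fun x => Ψ (r⁻¹ • (x - x₀))) (x₀ + x)) :=
      smul_nonneg (abs_nonneg _) h3
    nlinarith
  have hanti : AntitoneOn A (Ici 0) := by
    refine antitoneOn_of_deriv_nonpos (convex_Ici 0)
      (fun r _ => (hA' r).continuousAt.continuousWithinAt)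
      (fun r _ => (hA' r).differentiableAt.differentiableWithinAt) fun r hr => ?_
    rw [(hA' r).deriv]
    rw [interior_Ici] at hr
    exact hneg r hr
  have hAz : ∀ r, 0 ≤ r → A r ≤ 0 := fun r hr => by
    have := hanti self_mem_Ici hr hr
    simpa [hA, hx₀] using this
  -- The added 1 puts `x` strictly inside the ball of radius `r`, where the weight is positive; so
  -- `v x ≠ 0` would make `A r > 0`.
  set r := ‖x - x₀‖ + 1 with hr
  have hr0 : 0 < r := by positivity
  have hxr : x₀ + r • (r⁻¹ • (x - x₀)) = x := by
    rw [smul_inv_smul₀ hr0.ne']; simp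
  by_contra hx
  have hn : ‖r⁻¹ • (x - x₀)‖ < 1 := by
    rw [norm_smul, norm_inv, Real.norm_of_nonneg hr0.le, inv_mul_eq_div, div_lt_one hr0]
    linarith
  have := Continuous.integral_pos_of_hasCompactSupport_nonneg_nonzero
    (μ := (volume : Measure (EuclideanSpace ℝ (Fin N)))) (f := fun y => v (x₀ + r • y) * χ y) (x := r⁻¹ • (x - x₀)) (by fun_prop) hχs.mul_left
    (fun y => mul_nonneg (hv0 _) (hχ0 y)) (by
      simp only [hxr]
      refine mul_ne_zero hx ?_
      simp only [hχdef]
      rw [max_eq_left (by nlinarith [norm_nonneg (r⁻¹ • (x - x₀))])]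
      nlinarith [norm_nonneg (r⁻¹ • (x - x₀))])
  exact absurd (hAz r hr0.le) (not_le.2 this)

/-! ### The signed power and the change of variables -/

theorem signedPow_of_pos {γ t : ℝ} (ht : 0 < t) : signedPow γ t = t ^ γ := by
  rw [signedPow, abs_of_pos ht, Real.rpow_sub_one ht.ne', div_mul_cancel₀ _ ht.ne']

theorem signedPow_of_neg {γ t : ℝ} (ht : t < 0) : signedPow γ t = -(-t) ^ γ := by
  rw [signedPow, abs_of_neg ht, Real.rpow_sub_one (by linarith)]
  have := ht.ne
  field_simp

theorem hasDerivAt_signedPow {γ : ℝ} (hγ : 1 ≤ γ) (t : ℝ) :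
    HasDerivAt (signedPow γ) (γ * |t| ^ (γ - 1)) t := by
  rcases lt_trichotomy t 0 with ht | rfl | ht
  · have h1 := ((hasDerivAt_neg t).rpow_const (p := γ) (Or.inr hγ)).neg
    rw [abs_of_neg ht]
    refine (h1.congr_of_eventuallyEq ?_).congr_deriv (by ring)
    filter_upwards [Iio_mem_nhds ht] with s hs using signedPow_of_neg hs
  · rw [hasDerivAt_iff_tendsto_slope]
    have hc : Continuous fun s : ℝ => |s| ^ (γ - 1) :=
      continuous_abs.rpow_const fun _ => Or.inr (by linarith)
    have h2 := (hc.tendsto 0).mono_left (nhdsWithin_le_nhds (s := {0}ᶜ))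
    -- For `γ = 1` both sides are 1, since `0 ^ 0 = 1`; for `γ > 1` both are 0.
    have h3 : γ * |(0 : ℝ)| ^ (γ - 1) = |(0 : ℝ)| ^ (γ - 1) := by
      rcases hγ.eq_or_lt with rfl | h
      · simp
      · rw [abs_zero, Real.zero_rpow (by linarith), mul_zero]
    rw [h3]
    refine h2.congr' ?_
    filter_upwards [self_mem_nhdsWithin] with s hs
    have hs : s ≠ 0 := hs
    rw [slope_def_field]
    simp [signedPow, hs]
  · have h1 := Real.hasDerivAt_rpow_const (x := t) (p := γ) (Or.inr hγ)
    rw [abs_of_pos ht]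
    refine h1.congr_of_eventuallyEq ?_
    filter_upwards [Ioi_mem_nhds ht] with s hs using signedPow_of_pos hs

theorem contDiff_signedPow {γ : ℝ} (hγ : 1 ≤ γ) : ContDiff ℝ 1 (signedPow γ) := by
  rw [contDiff_one_iff_deriv]
  refine ⟨fun t => (hasDerivAt_signedPow hγ t).differentiableAt, ?_⟩
  have : deriv (signedPow γ) = fun t => γ * |t| ^ (γ - 1) :=
    funext fun t => (hasDerivAt_signedPow hγ t).deriv
  rw [this]
  exact continuous_const.mul (continuous_abs.rpow_const fun _ => Or.inr (by linarith))

theorem signedPow_neg_iff {γ t : ℝ} : signedPow γ t < 0 ↔ t < 0 := by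
  rcases lt_trichotomy t 0 with ht | rfl | ht
  · rw [signedPow_of_neg ht]
    simp [ht, Real.rpow_pos_of_pos (neg_pos.2 ht)]
  · simp [signedPow]
  · rw [signedPow_of_pos ht]
    exact iff_of_false (Real.rpow_pos_of_pos ht γ).le.not_gt ht.le.not_gt

theorem signedPow_eq_zero_iff {γ t : ℝ} : signedPow γ t = 0 ↔ t = 0 := by
  rcases lt_trichotomy t 0 with ht | rfl | ht
  · rw [signedPow_of_neg ht]
    simp [ht.ne, (Real.rpow_pos_of_pos (neg_pos.2 ht) γ).ne']
  · simp [signedPow]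
  · rw [signedPow_of_pos ht]
    simp [ht.ne', (Real.rpow_pos_of_pos ht γ).ne']

/-- Keeping only `[s/2, s]` bounds the inner integral below by a multiple of `s^(p+1)`; the exponent
`-(p+1)/2` is below -1 exactly when `p > 1`. -/
theorem kellerOsserman_rpow {C p : ℝ} (hC : 0 < C) (hp : 1 < p) :
    KellerOsserman fun s => C * s ^ p := by
  have hc : ContinuousOn (fun s : ℝ => C * s ^ p) (Ioi 0) :=
    (continuous_const.mul (Real.continuous_rpow_const (by linarith))).continuousOn
  have hpos : ∀ s : ℝ, 0 < s → 0 < C * s ^ p := fun s hs =>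
    mul_pos hC (Real.rpow_pos_of_pos hs _)
  have hi : IntegrableOn (fun s : ℝ => (C * (1 / 2) ^ (p + 1)) ^ (-(1 / 2) : ℝ) *
      s ^ (-(p + 1) / 2)) (Ioi 2) :=
    (integrableOn_Ioi_rpow_of_lt (by linarith) two_pos).const_mul _
  refine hi.mono' (((continuousOn_kellerOsserman_integrand hc hpos).mono
    (Ioi_subset_Ioi one_le_two)).aestronglyMeasurable measurableSet_Ioi) ?_
  filter_upwards [ae_restrict_mem measurableSet_Ioi] with s hs
  have hs : (2 : ℝ) < s := hs
  have hs0 : 0 < s := by linarith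
  have hJ := integral_pos_of_pos_on hc hpos (s := s) (by linarith)
  rw [Real.norm_of_nonneg (Real.rpow_nonneg hJ.le _)]
  have e1 : (C * (1 / 2) ^ (p + 1)) ^ (-(1 / 2) : ℝ) * s ^ (-(p + 1) / 2) =
      (C * (s / 2) ^ p * (s / 2)) ^ (-(1 / 2) : ℝ) := by
    have e2 : s ^ (-(p + 1) / 2) = (s ^ (p + 1)) ^ (-(1 / 2) : ℝ) := by
      rw [← Real.rpow_mul hs0.le]; congr 1; ring
    rw [e2, ← Real.mul_rpow (by positivity) (by positivity), mul_assoc, mul_assoc,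
      ← Real.mul_rpow (by positivity) (by positivity), ← Real.rpow_add_one (by positivity)]
    rw [one_div_mul_eq_div]
  rw [e1]
  refine Real.rpow_le_rpow_of_nonpos (by positivity) ?_ (by norm_num)
  rw [← intervalIntegral.integral_add_adjacent_intervals
    (intervalIntegrable_of_continuousOn_pos hc one_pos (by linarith : 0 < s / 2))
    (intervalIntegrable_of_continuousOn_pos hc (by linarith : 0 < s / 2) hs0)]
  have h1 : 0 ≤ ∫ t in (1 : ℝ)..(s / 2), C * t ^ p :=
    intervalIntegral.integral_nonneg (by linarith) fun t ht => (hpos t (by linarith [ht.1])).le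
  have h2 : ∫ t in (s / 2)..s, C * (s / 2) ^ p ≤ ∫ t in (s / 2)..s, C * t ^ p := by
    refine intervalIntegral.integral_mono_on (by linarith) (by simp)
      (intervalIntegrable_of_continuousOn_pos hc (by linarith : 0 < s / 2) hs0) fun t ht => ?_
    have := Real.rpow_le_rpow (by linarith : 0 ≤ s / 2) ht.1 (by linarith : 0 ≤ p)
    exact mul_le_mul_of_nonneg_left this hC.le
  rw [intervalIntegral.integral_const, smul_eq_mul] at h2
  have h3 : (s - s / 2) * (C * (s / 2) ^ p) = C * (s / 2) ^ p * (s / 2) := by ring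
  linarith

theorem integral_weighted_eq {γ : ℝ} (hγ : 1 ≤ γ) {f : ℝ → ℝ} (hf : Continuous f) {x : ℝ}
    (hx : 1 < x) : ∫ s in (-x)..(-1 : ℝ), f s * |s| ^ (γ - 1) =
      γ⁻¹ * ∫ t in (1 : ℝ)..(x ^ γ), f (-t ^ γ⁻¹) := by
  have hγ0 : 0 < γ := by linarith
  have h0 : ∀ s ∈ uIcc 1 x, (0 : ℝ) < s := fun s hs => by
    rw [uIcc_of_le hx.le] at hs; linarith [hs.1]
  have h1 := intervalIntegral.integral_comp_mul_deriv'' (a := 1) (b := x)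
    (f := fun s => s ^ γ) (f' := fun s => γ * s ^ (γ - 1)) (g := fun t => f (-t ^ γ⁻¹))
    (Real.continuous_rpow_const hγ0.le).continuousOn
    (fun s _ => (Real.hasDerivAt_rpow_const (Or.inr hγ)).hasDerivWithinAt)
    (continuous_const.mul (Real.continuous_rpow_const (by linarith))).continuousOn
    (hf.comp (Real.continuous_rpow_const (inv_nonneg.2 hγ0.le)).neg).continuousOn
  simp only [Real.one_rpow] at h1
  rw [← h1, ← intervalIntegral.integral_const_mul,
    ← intervalIntegral.integral_comp_neg (fun s => f s * |s| ^ (γ - 1))]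
  refine intervalIntegral.integral_congr fun s hs => ?_
  have hs0 := h0 s hs
  simp only [Function.comp, abs_neg, abs_of_pos hs0]
  rw [Real.rpow_rpow_inv hs0.le hγ0.ne']
  field_simp

/-- The substitution `s = |t|^γ` is made in both integrals: each weight `|t|^(γ-1)` is the Jacobian
up to the factor `γ`. -/
theorem kellerOsserman_of_weighted {γ : ℝ} (hγ : 1 ≤ γ) {f : ℝ → ℝ} (hf : Continuous f)
    (hpos : ∀ t < 0, 0 < f t) (hKO : WeightedKellerOsserman γ f) :
    KellerOsserman fun s => f (-s ^ γ⁻¹) := by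
  have hγ0 : 0 < γ := by linarith
  have hc : ContinuousOn (fun s => f (-s ^ γ⁻¹)) (Ioi 0) :=
    (hf.comp (Real.continuous_rpow_const (inv_nonneg.2 hγ0.le)).neg).continuousOn
  have hp : ∀ s : ℝ, 0 < s → 0 < f (-s ^ γ⁻¹) := fun s hs =>
    hpos _ (neg_lt_zero.2 (Real.rpow_pos_of_pos hs _))
  set P : ℝ → ℝ := fun s => (∫ t in (1 : ℝ)..s, f (-t ^ γ⁻¹)) ^ (-(1 / 2) : ℝ) with hP
  have h1 := ((Measure.measurePreserving_neg (volume : Measure ℝ)).integrableOn_comp_preimage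
    (Homeomorph.neg ℝ).measurableEmbedding).2 hKO
  have h2 : IntegrableOn (fun x => x ^ (γ - 1) * P (x ^ γ)) (Ioi 1) := by
    have h3 : IntegrableOn (fun x => (γ⁻¹ ^ (-(1 / 2) : ℝ))⁻¹ * (|(-x)| ^ (γ - 1) *
        (∫ s in (-x)..(-1 : ℝ), f s * |s| ^ (γ - 1)) ^ (-(1 / 2) : ℝ))) (Ioi 1) := by
      refine Integrable.const_mul ?_ _
      have e : (Neg.neg ⁻¹' Iio (-1) : Set ℝ) = Ioi 1 := by ext x; simp
      rw [e] at h1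
      exact h1
    refine h3.congr_fun (fun x hx => ?_) measurableSet_Ioi
    have hx : (1 : ℝ) < x := hx
    have hx0 : 0 < x := by linarith
    have hJ := integral_pos_of_pos_on hc hp (Real.one_lt_rpow hx hγ0)
    simp only
    rw [integral_weighted_eq hγ hf hx, Real.mul_rpow (inv_nonneg.2 hγ0.le) hJ.le, abs_neg,
      abs_of_pos hx0]
    have : 0 < γ⁻¹ ^ (-(1 / 2) : ℝ) := Real.rpow_pos_of_pos (inv_pos.2 hγ0) _
    rw [mul_left_comm (x ^ (γ - 1)), inv_mul_cancel_left₀ this.ne']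
  -- The power substitution acts on the whole half-line `(0, ∞)`, so `P` is extended by zero below
  -- 1; `x ↦ x^γ` preserves `(1, ∞)`.
  have h4 : IntegrableOn (fun x => x ^ (γ - 1) • (Ioi 1).indicator P (x ^ γ)) (Ioi 0) := by
    have h5 : IntegrableOn ((Ioi 1).indicator fun x => x ^ (γ - 1) * P (x ^ γ)) (Ioi 0) :=
      ((integrable_indicator_iff measurableSet_Ioi).2 h2).integrableOn
    refine h5.congr_fun (fun x hx => ?_) measurableSet_Ioi
    have hx : (0 : ℝ) < x := hx
    simp only [smul_eq_mul]
    by_cases h : 1 < x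
    · rw [indicator_of_mem (show x ∈ Ioi 1 from h),
        indicator_of_mem (show x ^ γ ∈ Ioi 1 from Real.one_lt_rpow h hγ0)]
    · rw [indicator_of_notMem (show x ∉ Ioi 1 from h), indicator_of_notMem, mul_zero]
      exact not_lt.2 (Real.rpow_le_one hx.le (not_lt.1 h) hγ0.le)
  have h6 := (integrableOn_Ioi_comp_rpow_iff' _ hγ0.ne').1 h4
  refine (h6.mono_set (Ioi_subset_Ioi zero_le_two)).congr_fun (fun x hx => ?_) measurableSet_Ioi
  exact indicator_of_mem (Ioi_subset_Ioi one_le_two hx) _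

/-! ### Conclusion -/

theorem mainTheorem12 (N : ℕ) (hN : 2 ≤ N) (γ : ℝ) (hγ : 1 ≤ γ)
    (f : ℝ → ℝ) (hf : Continuous f)
    (u : EuclideanSpace ℝ (Fin N) → ℝ) (hu : IsPorousSupersolution N γ f u) :
    (PosAntitoneOnNeg f → WeightedKellerOsserman γ f → ∀ x, 0 ≤ u x) ∧
    (∀ C q : ℝ, 0 < C → γ < q → (∀ t < 0, C * |t| ^ q ≤ f t) →
      (∀ x, 0 ≤ u x) ∧
      ((∀ t, 0 ≤ t → 0 ≤ f t) → (∀ x, u x = 0) ∨ (∀ x, 0 < u x))) := by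
  obtain ⟨huc, huw⟩ := hu
  have hγ0 : 0 < γ := by linarith
  have hN1 : 1 ≤ N := by omega
  have hv : ContDiff ℝ 1 fun x => signedPow γ (u x) := (contDiff_signedPow hγ).comp huc
  have hF : Continuous fun x => f (u x) := hf.comp huc.continuous
  have hvF : IsWeakSupersolution (fun x => signedPow γ (u x)) fun x => f (u x) := huw
  have hroot : ∀ {t : ℝ}, t < 0 → -signedPow γ t = (-t) ^ γ := fun ht => by
    rw [signedPow_of_neg ht, neg_neg]
  -- Common core of (i) and (ii): since `-v = (-u)^γ` where `u < 0`, it is enough to bound `f` below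
  -- by such an `h` evaluated at `(-t)^γ`.
  have hnonneg : ∀ {h : ℝ → ℝ}, ContinuousOn h (Ioi 0) → MonotoneOn h (Ioi 0) →
      (∀ s, 0 < s → 0 < h s) → KellerOsserman h → (∀ t < 0, h ((-t) ^ γ) ≤ f t) →
      ∀ x, 0 ≤ u x := fun hc hm hp hKO hh x => by
    have := nonneg_of_kellerOsserman hN1 hv hF hvF hc hm hp hKO (fun x hx => by
      have hx := signedPow_neg_iff.1 hx
      rw [hroot hx]; exact hh _ hx) x
    by_contra! hneg
    exact absurd (signedPow_neg_iff.2 hneg) this.not_gt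
  refine ⟨fun ⟨hpos, hanti⟩ hKO => ?_, fun C q hC hq hfq => ?_⟩
  · refine hnonneg (h := fun s => f (-s ^ γ⁻¹)) ?_ ?_ ?_
      (kellerOsserman_of_weighted hγ hf hpos hKO) ?_
    · exact (hf.comp (Real.continuous_rpow_const (inv_nonneg.2 hγ0.le)).neg).continuousOn
    · intro s hs t ht hst
      have hs : 0 < s := hs
      have ht : 0 < t := ht
      refine hanti (neg_lt_zero.2 (Real.rpow_pos_of_pos ht _))
        (neg_lt_zero.2 (Real.rpow_pos_of_pos hs _)) (neg_le_neg ?_)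
      exact Real.rpow_le_rpow hs.le hst (inv_nonneg.2 hγ0.le)
    · exact fun s hs => hpos _ (neg_lt_zero.2 (Real.rpow_pos_of_pos hs _))
    · intro t ht
      rw [Real.rpow_rpow_inv (by linarith) hγ0.ne', neg_neg]
  · have hq0 : 0 < q := hγ0.trans hq
    have hp : 1 < q / γ := (one_lt_div hγ0).2 hq
    have hu0 : ∀ x, 0 ≤ u x := by
      refine hnonneg (h := fun s => C * s ^ (q / γ)) ?_ ?_ ?_ (kellerOsserman_rpow hC hp) ?_
      · exact (continuous_const.mul (Real.continuous_rpow_const (by linarith))).continuousOn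
      · intro s hs t _ hst
        have hs : 0 < s := hs
        exact mul_le_mul_of_nonneg_left (Real.rpow_le_rpow hs.le hst (by linarith)) hC.le
      · exact fun s hs => mul_pos hC (Real.rpow_pos_of_pos hs _)
      · intro t ht
        rw [← Real.rpow_mul (by linarith), mul_div_cancel₀ _ hγ0.ne', ← abs_of_neg ht]
        exact hfq t ht
    refine ⟨hu0, fun hf0 => ?_⟩
    by_cases hz : ∃ x₀, u x₀ = 0
    · obtain ⟨x₀, hx₀⟩ := hz
      left
      intro x
      have hv0 : ∀ x, 0 ≤ signedPow γ (u x) := fun x =>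
        not_lt.1 fun h => (hu0 x).not_gt (signedPow_neg_iff.1 h)
      exact signedPow_eq_zero_iff.1 (eq_zero_of_isWeakSupersolution hv hvF
        (fun x => hf0 _ (hu0 x)) hv0 (signedPow_eq_zero_iff.2 hx₀) x)
    · right
      exact fun x => (hu0 x).lt_of_ne' fun h => hz ⟨x, h⟩
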